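/- Let $\Omega=(a,b)\subset\mathbb{R}$ be a bounded open interval and let $f\in BV(\Omega)$. Let $\alpha\in C(\overline{\Omega})$ with $\alpha>0$ on $\overline{\Omega}$, and suppose that $\alpha$ has a weak derivative $\alpha'\in L^1(\Omega)$ with $\alpha'\in BV(\Omega)$. For $w\in BV(\Omega)$ write $Dw$ for its distributional derivative, a finite signed Radon measure on $\Omega$, and $|Dw|$ for the total variation measure of $Dw$. Let $u\in BV(\Omega)$ be a solution of the weighted total variation problem $$\min_{w\in BV(\Omega)}\ \frac12\int_\Omega (f-w)^2\,dx+\int_\Omega \alpha\,d|Dw| .$$ Let $x\in\Omega$ be a jump point of $f$, i.e. $|Df|(\{x\})\neq 0$, and suppose that $D\alpha'(\{x\})>0$. Then $$|Du|(\{x\})\le |Df|(\{x\})+D\alpha'(\{x\}).$$ -/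

import Mathlib

open MeasureTheory Set

namespace WeightedTV

/-- Test functions on `Ω = (a, b)`: continuously differentiable functions whose (closed) support
is a compact subset of `(a, b)`. -/
def IsTestFunction (a b : ℝ) (φ : ℝ → ℝ) : Prop :=
  ContDiff ℝ 1 φ ∧ HasCompactSupport φ ∧ tsupport φ ⊆ Ioo a b

/-- `u ∈ BV(Ω)`, `Ω = (a, b)`, with distributional derivative the finite signed Radon measure `Du`
on `Ω`: `u ∈ L¹(Ω)` and `∫_Ω u φ' dx = - ∫_Ω φ dDu` for every test function `φ`.
The measure `Du` on `Ω` is recorded as a signed measure on `ℝ` that vanishes outside `Ω`;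
it is determined by `u`. The values of `u` outside `Ω` play no role. -/
structure HasBVDeriv (a b : ℝ) (u : ℝ → ℝ) (Du : SignedMeasure ℝ) : Prop where
  integrableOn : IntegrableOn u (Ioo a b)
  concentrated : Du.totalVariation (Ioo a b)ᶜ = 0
  integral_eq : ∀ φ : ℝ → ℝ, IsTestFunction a b φ →
    ∫ x in Ioo a b, u x * deriv φ x = - ∫ᵛ x, φ x ∂•Du

/-- `g ∈ L¹(Ω)` is the weak derivative of `α` on `Ω = (a, b)`. -/
structure HasWeakDeriv (a b : ℝ) (α g : ℝ → ℝ) : Prop where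
  integrableOn : IntegrableOn α (Ioo a b)
  integrableOn_deriv : IntegrableOn g (Ioo a b)
  integral_eq : ∀ φ : ℝ → ℝ, IsTestFunction a b φ →
    ∫ x in Ioo a b, α x * deriv φ x = - ∫ x in Ioo a b, g x * φ x

/-- The weighted total variation functional `½ ∫_Ω (f - u)² dx + ∫_Ω α d|Du|` on `Ω = (a, b)`,
for `u ∈ BV(Ω)` with derivative `Du`. (On a bounded interval functions of bounded variation are
essentially bounded, so the first integrand is integrable.) -/
noncomputable def energy (a b : ℝ) (f α u : ℝ → ℝ) (Du : SignedMeasure ℝ) : ℝ :=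
  (1 / 2) * (∫ x in Ioo a b, (f x - u x) ^ 2) + ∫ x in Ioo a b, α x ∂Du.totalVariation

/-- `u`, with distributional derivative `Du`, solves the weighted total variation problem with
data `f` and weight `α`: `u ∈ BV(Ω)` and `u` minimises the functional over all of `BV(Ω)`. -/
def IsSolution (a b : ℝ) (f α u : ℝ → ℝ) (Du : SignedMeasure ℝ) : Prop :=
  HasBVDeriv a b u Du ∧
    ∀ (w : ℝ → ℝ) (Dw : SignedMeasure ℝ), HasBVDeriv a b w Dw →
      energy a b f α u Du ≤ energy a b f α w Dw

end WeightedTV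

open Filter Topology
open scoped Convolution

namespace WeightedTV

/-! The proof is a first variation argument with a perturbation that shrinks the jump of `u` at `x`.
Replacing `u, f` by `-u, -f` changes neither the energy nor `α`, so an upward jump `Du {x} > 0` may
be assumed; if there is no jump, nothing is to be shown.

Let `ψ(t) = 3 (h - |t - x|)₊² sign (t - x)`. It jumps upwards at `x`, and the derivative of `-ψ` is
the density `6 (h - |t - x|)₊` minus an atom of mass `c` at `x`. For small `ε > 0` the function `u -
εψ` has a smaller but still nonnegative jump at `x`, so the weighted variation grows by at most `ε
(∫ 6 α (h - |t - x|)₊ dt - c α(x))`. Integrating by parts, this is `ε ∫ α' ψ`. Minimality, division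
by `ε` and `ε → 0` give `0 ≤ ∫ (f - u + α') ψ` (`IsSolution.integral_mul_jumpProfile_nonneg`).

Now `ψ` is itself the derivative of `-(h - |t - x|)₊³`, so the last integral is `∫ (h - |t - x|)₊³
d(Df - Du + Dα')`. Divided by `h³`, it tends to the mass of `{x}` as `h → 0`. Hence `Du {x} ≤ Df {x}
+ Dα' {x}` (`IsSolution.jump_le`).

Since `ψ` jumps and `(h - |t - x|)₊³` has a kink at `x`, neither is a `C¹` test function. Both
identities are therefore proved with `|y|` replaced by `√(y² + δ²)`, and then `δ → 0`. -/

theorem hasDerivAt_max_zero_pow (n : ℕ) (s : ℝ) :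
    HasDerivAt (fun s : ℝ => (max s 0) ^ (n + 2)) ((n + 2) * (max s 0) ^ (n + 1)) s := by
  rcases lt_trichotomy s 0 with hs | rfl | hs
  · have : (fun s : ℝ => (max s 0) ^ (n + 2)) =ᶠ[𝓝 s] fun _ => 0 := by
      filter_upwards [Iio_mem_nhds hs] with y hy
      rw [max_eq_right (le_of_lt hy)]; simp
    rw [max_eq_right hs.le]
    simpa using (hasDerivAt_const s (0 : ℝ)).congr_of_eventuallyEq this
  · simp only [max_self, ne_eq, Nat.add_eq_zero_iff, one_ne_zero, and_false, not_false_eq_true,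
      zero_pow, mul_zero]
    rw [hasDerivAt_iff_isLittleO_nhds_zero]
    simp only [zero_add, max_self, ne_eq, Nat.add_eq_zero_iff, OfNat.ofNat_ne_zero, and_false,
      not_false_eq_true, zero_pow, sub_zero, smul_eq_mul, mul_zero]
    have h1 : (fun y : ℝ => (max y 0) ^ (n + 2)) =O[𝓝 0] fun y : ℝ => y ^ (n + 2) := by
      refine Asymptotics.IsBigO.of_bound 1 (Eventually.of_forall fun y => ?_)
      rw [norm_pow, norm_pow, one_mul]
      gcongr
      rcases le_total y 0 with hy | hy <;> simp [hy]
    refine h1.trans_isLittleO ?_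
    simpa using Asymptotics.isLittleO_pow_id (𝕜 := ℝ) (n := n + 2) (by omega)
  · have : (fun s : ℝ => (max s 0) ^ (n + 2)) =ᶠ[𝓝 s] fun s => s ^ (n + 2) := by
      filter_upwards [Ioi_mem_nhds hs] with y hy
      rw [max_eq_left (le_of_lt hy)]
    rw [max_eq_left hs.le]
    simpa using (hasDerivAt_pow (n + 2) s).congr_of_eventuallyEq this

/-! ### Smoothed distance, truncated powers and the jump profile -/

/-- The smoothed absolute value `√(y² + δ²)`. -/
noncomputable def smoothAbs (δ y : ℝ) : ℝ := √(y ^ 2 + δ ^ 2)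

theorem smoothAbs_zero (y : ℝ) : smoothAbs 0 y = |y| := by
  simp [smoothAbs, Real.sqrt_sq_eq_abs]

theorem smoothAbs_pos {δ : ℝ} (hδ : 0 < δ) (y : ℝ) : 0 < smoothAbs δ y :=
  Real.sqrt_pos.2 (by positivity)

theorem smoothAbs_nonneg (δ y : ℝ) : 0 ≤ smoothAbs δ y := Real.sqrt_nonneg _

theorem sq_smoothAbs (δ y : ℝ) : smoothAbs δ y ^ 2 = y ^ 2 + δ ^ 2 :=
  Real.sq_sqrt (by positivity)

theorem abs_le_smoothAbs (δ y : ℝ) : |y| ≤ smoothAbs δ y := by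
  rw [← Real.sqrt_sq_eq_abs]
  exact Real.sqrt_le_sqrt (by nlinarith [sq_nonneg δ])

@[fun_prop]
theorem continuous_smoothAbs_left (y : ℝ) : Continuous fun δ => smoothAbs δ y := by
  unfold smoothAbs; fun_prop

@[fun_prop]
theorem continuous_smoothAbs_right (δ : ℝ) : Continuous (smoothAbs δ) := by
  unfold smoothAbs; fun_prop

theorem hasDerivAt_smoothAbs {δ : ℝ} (hδ : 0 < δ) (y : ℝ) :
    HasDerivAt (smoothAbs δ) (y / smoothAbs δ y) y := by
  have h := ((hasDerivAt_pow 2 y).add_const (δ ^ 2)).sqrt (by positivity)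
  refine h.congr_deriv ?_
  have := (smoothAbs_pos hδ y).ne'
  unfold smoothAbs at *
  field_simp
  simp

/-- The truncated distance `(h - √(y² + δ²))₊`. -/
noncomputable def hat (h δ y : ℝ) : ℝ := max (h - smoothAbs δ y) 0

theorem hat_nonneg (h δ y : ℝ) : 0 ≤ hat h δ y := le_max_right _ _

theorem hat_le {h : ℝ} (hh : 0 < h) (δ y : ℝ) : hat h δ y ≤ h :=
  max_le (by linarith [smoothAbs_nonneg δ y]) hh.le

theorem hat_eq_zero {h y : ℝ} (δ : ℝ) (hy : h ≤ |y|) : hat h δ y = 0 :=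
  max_eq_right (by linarith [abs_le_smoothAbs δ y])

@[fun_prop]
theorem continuous_hat_left (h y : ℝ) : Continuous fun δ => hat h δ y := by
  unfold hat; fun_prop

@[fun_prop]
theorem continuous_hat_right (h δ : ℝ) : Continuous (hat h δ) := by
  unfold hat; fun_prop

theorem hat_zero_zero {h : ℝ} (hh : 0 < h) : hat h 0 0 = h := by
  simp [hat, smoothAbs, hh.le]

theorem hasDerivAt_hat_pow (h : ℝ) {δ : ℝ} (hδ : 0 < δ) (n : ℕ) (y : ℝ) :
    HasDerivAt (fun y => hat h δ y ^ (n + 2))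
      (-((n + 2) * hat h δ y ^ (n + 1) * (y / smoothAbs δ y))) y := by
  have := (hasDerivAt_max_zero_pow n (h - smoothAbs δ y)).comp y
    ((hasDerivAt_smoothAbs hδ y).const_sub h)
  refine this.congr_deriv ?_
  unfold hat
  ring

/-- The derivative of `-(h - √(y² + δ²))₊³`. For `δ = 0` this function jumps at the origin
and is continuously differentiable elsewhere. -/
noncomputable def jumpProfile (h δ y : ℝ) : ℝ := 3 * hat h δ y ^ 2 * (y / smoothAbs δ y)

theorem abs_div_smoothAbs_le (δ y : ℝ) : |y / smoothAbs δ y| ≤ 1 := by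
  rw [abs_div, abs_of_nonneg (smoothAbs_nonneg δ y)]
  exact div_le_one_of_le₀ (abs_le_smoothAbs δ y) (smoothAbs_nonneg δ y)

theorem abs_jumpProfile_le {h : ℝ} (hh : 0 < h) (δ y : ℝ) : |jumpProfile h δ y| ≤ 3 * h ^ 2 := by
  have h1 := hat_le hh δ y
  have h2 := hat_nonneg h δ y
  rw [jumpProfile, abs_mul, abs_of_nonneg (by positivity : 0 ≤ 3 * hat h δ y ^ 2)]
  calc 3 * hat h δ y ^ 2 * |y / smoothAbs δ y| ≤ 3 * h ^ 2 * 1 := by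
        gcongr
        exact abs_div_smoothAbs_le δ y
    _ = _ := by ring

theorem measurable_jumpProfile (h δ : ℝ) : Measurable (jumpProfile h δ) := by
  unfold jumpProfile
  have := (continuous_hat_right h δ).measurable
  have := (continuous_smoothAbs_right δ).measurable
  fun_prop

theorem tendsto_jumpProfile (h y : ℝ) :
    Tendsto (fun δ => jumpProfile h δ y) (𝓝[>] 0) (𝓝 (jumpProfile h 0 y)) := by
  -- At the origin all profiles vanish; for `δ = 0` this is the convention `0 / 0 = 0`, so
  -- convergence holds at every point.
  rcases eq_or_ne y 0 with rfl | hy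
  · simp [jumpProfile]
  · refine tendsto_nhdsWithin_of_tendsto_nhds (ContinuousAt.tendsto ?_)
    unfold jumpProfile
    have : smoothAbs 0 y ≠ 0 := by simpa [smoothAbs_zero] using hy
    fun_prop (disch := assumption)

/-- The derivative of `jumpProfile h δ`, `δ > 0`, is the sum of a concentrating part and of a
part that converges boundedly. -/
noncomputable def jumpProfileDeriv (h δ y : ℝ) : ℝ :=
  3 * hat h δ y ^ 2 * (δ ^ 2 / smoothAbs δ y ^ 3) - 6 * hat h δ y * (y / smoothAbs δ y) ^ 2

theorem hasDerivAt_jumpProfile (h : ℝ) {δ : ℝ} (hδ : 0 < δ) (y : ℝ) :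
    HasDerivAt (jumpProfile h δ) (jumpProfileDeriv h δ y) y := by
  have hq := smoothAbs_pos hδ y
  have h1 := ((hasDerivAt_hat_pow h hδ 0 y).const_mul 3).mul
    ((hasDerivAt_id y).div (hasDerivAt_smoothAbs hδ y) hq.ne')
  refine h1.congr_deriv ?_
  simp only [jumpProfileDeriv, Pi.div_apply, id]
  -- Eliminating `δ` leaves a rational identity in `y`, `smoothAbs δ y` and `hat h δ y`.
  have h2 : δ ^ 2 = smoothAbs δ y ^ 2 - y ^ 2 := by rw [sq_smoothAbs]; ring
  rw [h2]
  field_simp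
  push_cast
  ring

theorem continuous_jumpProfile (h : ℝ) {δ : ℝ} (hδ : 0 < δ) : Continuous (jumpProfile h δ) :=
  continuous_iff_continuousAt.2 fun y => (hasDerivAt_jumpProfile h hδ y).continuousAt

theorem continuous_jumpProfileDeriv (h : ℝ) {δ : ℝ} (hδ : 0 < δ) :
    Continuous (jumpProfileDeriv h δ) := by
  unfold jumpProfileDeriv
  have h1 : ∀ y, smoothAbs δ y ≠ 0 := fun y => (smoothAbs_pos hδ y).ne'
  have h2 : ∀ y, smoothAbs δ y ^ 3 ≠ 0 := fun y => pow_ne_zero _ (h1 y)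
  fun_prop (disch := assumption)

/-! ### Testing derivatives with the profiles, and the limit `δ → 0` -/

theorem isTestFunction_comp_sub {a b h x : ℝ} {F F' : ℝ → ℝ} (hF : ∀ y, HasDerivAt F (F' y) y)
    (hF' : Continuous F') (h0 : ∀ y, h ≤ |y| → F y = 0) (hl : a < x - h) (hr : x + h < b) :
    IsTestFunction a b fun t => F (t - x) := by
  have hd : ∀ t, HasDerivAt (fun t => F (t - x)) (F' (t - x)) t := fun t =>
    (hF (t - x)).comp_sub_const t x
  have hs : tsupport (fun t => F (t - x)) ⊆ Icc (x - h) (x + h) := by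
    refine closure_minimal (fun t ht => ?_) isClosed_Icc
    by_contra hc
    refine ht (h0 _ ?_)
    by_contra! hlt
    rw [abs_lt] at hlt
    exact hc ⟨by linarith, by linarith⟩
  refine ⟨?_, ?_, fun t ht => ?_⟩
  · rw [contDiff_one_iff_deriv]
    refine ⟨fun t => (hd t).differentiableAt, ?_⟩
    rw [funext fun t => (hd t).deriv]
    fun_prop
  · exact isCompact_Icc.of_isClosed_subset (isClosed_tsupport _) hs
  · have := hs ht
    exact ⟨by linarith [this.1], by linarith [this.2]⟩

theorem isFiniteMeasure_variation (μ : SignedMeasure ℝ) : IsFiniteMeasure μ.variation := by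
  rw [← SignedMeasure.totalVariation_eq_variation]; infer_instance

/-- The definition of the derivative of a function of bounded variation, tested with the Lipschitz
function `-(h - |t - x|)₊³`. -/
theorem HasBVDeriv.integral_mul_jumpProfile {a b h x : ℝ} {g : ℝ → ℝ} {Dg : SignedMeasure ℝ}
    (hg : HasBVDeriv a b g Dg) (hh : 0 < h) (hl : a < x - h) (hr : x + h < b) :
    ∫ t in Ioo a b, g t * jumpProfile h 0 (t - x) = ∫ᵛ t, hat h 0 (t - x) ^ 3 ∂•Dg := by
  have hpos : ∀ᶠ δ : ℝ in 𝓝[>] 0, 0 < δ := eventually_mem_nhdsWithin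
  have := isFiniteMeasure_variation Dg
  have key : ∀ δ : ℝ, 0 < δ → ∫ t in Ioo a b, g t * jumpProfile h δ (t - x)
      = ∫ᵛ t, hat h δ (t - x) ^ 3 ∂•Dg := by
    intro δ hδ
    have hd : ∀ y, HasDerivAt (fun y => -hat h δ y ^ 3) (jumpProfile h δ y) y := fun y => by
      refine (hasDerivAt_hat_pow h hδ 1 y).neg.congr_deriv ?_
      rw [jumpProfile]; push_cast; ring
    have ht := isTestFunction_comp_sub (x := x) hd (continuous_jumpProfile h hδ)
      (fun y hy => by simp [hat_eq_zero δ hy]) hl hr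
    have := hg.integral_eq _ ht
    rw [VectorMeasure.integral_fun_neg, neg_neg] at this
    rw [← this]
    congr! 3 with t
    exact ((hd (t - x)).comp_sub_const t x).deriv.symm
  have lim1 : Tendsto (fun δ => ∫ t in Ioo a b, g t * jumpProfile h δ (t - x)) (𝓝[>] 0)
      (𝓝 (∫ t in Ioo a b, g t * jumpProfile h 0 (t - x))) := by
    refine tendsto_integral_filter_of_dominated_convergence (fun t => |g t| * (3 * h ^ 2))
      (Eventually.of_forall fun δ => hg.integrableOn.1.mul
        ((measurable_jumpProfile h δ).comp (measurable_id.sub_const x)).aestronglyMeasurable)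
      (Eventually.of_forall fun δ => Eventually.of_forall fun t => ?_)
      (hg.integrableOn.abs.mul_const _)
      (Eventually.of_forall fun t => (tendsto_jumpProfile h (t - x)).const_mul _)
    rw [norm_mul]
    exact mul_le_mul_of_nonneg_left (abs_jumpProfile_le hh δ _) (norm_nonneg _)
  have lim2 : Tendsto (fun δ => ∫ᵛ t, hat h δ (t - x) ^ 3 ∂•Dg) (𝓝[>] 0)
      (𝓝 (∫ᵛ t, hat h 0 (t - x) ^ 3 ∂•Dg)) := by
    refine VectorMeasure.tendsto_integral_filter_of_norm_le_const
      (Eventually.of_forall fun δ => Continuous.aestronglyMeasurable (by fun_prop))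
      ⟨h ^ 3, Eventually.of_forall fun δ => Eventually.of_forall fun t => ?_⟩
      (Eventually.of_forall fun t => tendsto_nhdsWithin_of_tendsto_nhds
        (Continuous.tendsto (f := fun δ => hat h δ (t - x) ^ 3) (by fun_prop) 0))
    rw [Real.norm_of_nonneg (pow_nonneg (hat_nonneg _ _ _) _)]
    exact pow_le_pow_left₀ (hat_nonneg _ _ _) (hat_le hh _ _) _
  refine tendsto_nhds_unique lim1 (lim2.congr' ?_)
  filter_upwards [hpos] with δ hδ using (key δ hδ).symm

/-- The mass `∫ (1 + z²)^(-3/2) dz` of the concentrating part of `jumpProfileDeriv`. -/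
noncomputable def kernelMass : ℝ := ∫ z : ℝ, 1 / √(1 + z ^ 2) ^ 3

/-- The mass equals `2`, but only its sign matters: it enters the atom of the perturbation and the
integration by parts for `α` with the same factor, and cancels. -/
theorem kernelMass_nonneg : 0 ≤ kernelMass := integral_nonneg fun z => by positivity

theorem integrable_kernel : Integrable fun z : ℝ => 1 / √(1 + z ^ 2) ^ 3 := by
  have h0 : ∀ z : ℝ, 0 < √(1 + z ^ 2) := fun z => Real.sqrt_pos.2 (by positivity)
  refine integrable_inv_one_add_sq.mono' (Continuous.aestronglyMeasurable ?_)
    (Eventually.of_forall fun z => ?_)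
  · have : ∀ z : ℝ, √(1 + z ^ 2) ^ 3 ≠ 0 := fun z => pow_ne_zero _ (h0 z).ne'
    fun_prop (disch := assumption)
  · rw [Real.norm_of_nonneg (by have := h0 z; positivity), one_div]
    have h1 : 1 ≤ √(1 + z ^ 2) := by
      rw [Real.one_le_sqrt]; nlinarith [sq_nonneg z]
    gcongr
    calc 1 + z ^ 2 = √(1 + z ^ 2) ^ 2 := (Real.sq_sqrt (by positivity)).symm
      _ ≤ √(1 + z ^ 2) ^ 3 := pow_le_pow_right₀ h1 (by norm_num)

/-- The substitution `t = x + δz` turns `δ² / smoothAbs δ (t - x) ^ 3 dt` into the fixed integrable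
kernel `(1 + z²)^(-3/2) dz`, so this part of the derivative is an approximate identity at `x`.
Dominated convergence then needs only boundedness of `A` and continuity at `x`. -/
theorem tendsto_integral_concentrating {h x M : ℝ} {A : ℝ → ℝ} (hA : Measurable A)
    (hM : ∀ t, |A t| ≤ M) (hx : ContinuousAt A x) (hh : 0 < h) :
    Tendsto (fun δ => ∫ t, A t * (3 * hat h δ (t - x) ^ 2 * (δ ^ 2 / smoothAbs δ (t - x) ^ 3)))
      (𝓝[>] 0) (𝓝 (A x * (3 * h ^ 2) * kernelMass)) := by
  have hpos : ∀ᶠ δ : ℝ in 𝓝[>] 0, 0 < δ := eventually_mem_nhdsWithin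
  have hM0 : 0 ≤ M := (abs_nonneg _).trans (hM 0)
  have hsub : ∀ δ : ℝ, 0 < δ →
      ∫ z, A (x + δ * z) * (3 * hat h δ (δ * z) ^ 2) * (1 / √(1 + z ^ 2) ^ 3)
      = ∫ t, A t * (3 * hat h δ (t - x) ^ 2 * (δ ^ 2 / smoothAbs δ (t - x) ^ 3)) := by
    intro δ hδ
    let G : ℝ → ℝ := fun t => A (x + t) * (3 * hat h δ t ^ 2 * (δ ^ 2 / smoothAbs δ t ^ 3))
    have e1 : ∫ t, A t * (3 * hat h δ (t - x) ^ 2 * (δ ^ 2 / smoothAbs δ (t - x) ^ 3))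
        = ∫ t, G t := by
      rw [← integral_sub_right_eq_self G x]
      simp [G]
    have e2 := Measure.integral_comp_mul_left G δ
    rw [e1]
    have e3 : ∫ t, G t = ∫ z, δ * G (δ * z) := by
      rw [integral_const_mul, e2, abs_of_pos (inv_pos.2 hδ), smul_eq_mul, ← mul_assoc,
        mul_inv_cancel₀ hδ.ne', one_mul]
    rw [e3]
    congr! 2 with z
    have h1 : smoothAbs δ (δ * z) = δ * √(1 + z ^ 2) := by
      rw [smoothAbs, show (δ * z) ^ 2 + δ ^ 2 = δ ^ 2 * (1 + z ^ 2) by ring,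
        Real.sqrt_mul (by positivity), Real.sqrt_sq hδ.le]
    have h2 : 0 < √(1 + z ^ 2) := Real.sqrt_pos.2 (by positivity)
    simp only [G, h1]
    field_simp
  have hlim : Tendsto (fun δ => ∫ z, A (x + δ * z) * (3 * hat h δ (δ * z) ^ 2)
      * (1 / √(1 + z ^ 2) ^ 3)) (𝓝[>] 0) (𝓝 (∫ z, A x * (3 * h ^ 2) * (1 / √(1 + z ^ 2) ^ 3))) := by
    refine tendsto_integral_filter_of_dominated_convergence
      (fun z => M * (3 * h ^ 2) * (1 / √(1 + z ^ 2) ^ 3))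
      (Eventually.of_forall fun δ => ?_)
      (Eventually.of_forall fun δ => Eventually.of_forall fun z => ?_)
      (integrable_kernel.const_mul _)
      (Eventually.of_forall fun z => tendsto_nhdsWithin_of_tendsto_nhds ?_)
    · have := (continuous_hat_right h δ).measurable
      exact Measurable.aestronglyMeasurable (by fun_prop)
    · have h1 := hat_le hh δ (δ * z)
      have h2 := hat_nonneg h δ (δ * z)
      rw [norm_mul, norm_mul, Real.norm_of_nonneg (by positivity : 0 ≤ 3 * hat h δ (δ * z) ^ 2),
        Real.norm_of_nonneg (by positivity : 0 ≤ 1 / √(1 + z ^ 2) ^ 3)]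
      gcongr
      exact hM _
    · refine Tendsto.mul_const _ (Tendsto.mul ?_ ?_)
      · refine Tendsto.comp hx ?_
        have : Continuous fun δ : ℝ => x + δ * z := by fun_prop
        simpa using this.tendsto 0
      · have : Continuous fun δ : ℝ => 3 * hat h δ (δ * z) ^ 2 := by
          unfold hat smoothAbs; fun_prop
        have h3 := this.tendsto 0
        simpa [hat_zero_zero hh] using h3
  rw [integral_const_mul] at hlim
  refine hlim.congr' ?_
  filter_upwards [hpos] with δ hδ using hsub δ hδ

/-- Integration by parts of an absolutely continuous function against `jumpProfile h 0`. -/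
theorem HasWeakDeriv.integral_mul_jumpProfile {a b h x : ℝ} {α g : ℝ → ℝ}
    (hα : ContinuousOn α (Icc a b)) (hg : HasWeakDeriv a b α g) (hh : 0 < h)
    (hl : a < x - h) (hr : x + h < b) :
    ∫ t in Ioo a b, g t * jumpProfile h 0 (t - x)
      = (∫ t in Ioo a b, α t * (6 * hat h 0 (t - x))) - 3 * h ^ 2 * kernelMass * α x := by
  have hpos : ∀ᶠ δ : ℝ in 𝓝[>] 0, 0 < δ := eventually_mem_nhdsWithin
  have hxI : x ∈ Ioo a b := ⟨by linarith, by linarith⟩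
  -- The rescaling takes place on the whole line, whereas `α` is controlled only on the interval;
  -- extension by zero keeps it bounded and measurable.
  let A : ℝ → ℝ := (Ioo a b).indicator α
  have hAm : Measurable A := by
    have h0 : ContinuousOn (0 : ℝ → ℝ) (Ioo a b)ᶜ := continuousOn_const
    simpa only [Set.piecewise_eq_indicator] using
      (hα.mono Ioo_subset_Icc_self).measurable_piecewise h0 measurableSet_Ioo
  obtain ⟨M, hM⟩ : ∃ M, ∀ t, |A t| ≤ M := by
    obtain ⟨M, hM⟩ := isCompact_Icc.exists_bound_of_continuousOn hα
    refine ⟨M, fun t => ?_⟩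
    by_cases ht : t ∈ Ioo a b
    · simpa [A, ht] using hM t (Ioo_subset_Icc_self ht)
    · simpa [A, ht] using (norm_nonneg _).trans (hM x (Ioo_subset_Icc_self hxI))
  have hAx : A x = α x := by simp [A, hxI.1, hxI.2]
  have hAc : ContinuousAt A x := by
    have h1 : ContinuousAt α x := hα.continuousAt (Icc_mem_nhds hxI.1 hxI.2)
    refine h1.congr ?_
    filter_upwards [Ioo_mem_nhds hxI.1 hxI.2] with t ht
    simp [A, ht.1, ht.2]
  have key : ∀ δ : ℝ, 0 < δ →
      (∫ t, A t * (3 * hat h δ (t - x) ^ 2 * (δ ^ 2 / smoothAbs δ (t - x) ^ 3)))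
        - ∫ t in Ioo a b, α t * (6 * hat h δ (t - x) * ((t - x) / smoothAbs δ (t - x)) ^ 2)
      = - ∫ t in Ioo a b, g t * jumpProfile h δ (t - x) := by
    intro δ hδ
    have ht := isTestFunction_comp_sub (x := x) (hasDerivAt_jumpProfile h hδ)
      (continuous_jumpProfileDeriv h hδ)
      (fun y hy => by simp [jumpProfile, hat_eq_zero δ hy]) hl hr
    rw [← hg.integral_eq _ ht]
    have e1 : (∫ t, A t * (3 * hat h δ (t - x) ^ 2 * (δ ^ 2 / smoothAbs δ (t - x) ^ 3)))
        = ∫ t in Ioo a b, α t * (3 * hat h δ (t - x) ^ 2 * (δ ^ 2 / smoothAbs δ (t - x) ^ 3)) := by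
      rw [← integral_indicator measurableSet_Ioo]
      congr! 2 with t
      by_cases ht : t ∈ Ioo a b <;> simp [A, ht]
    have h1 : ∀ y, smoothAbs δ y ≠ 0 := fun y => (smoothAbs_pos hδ y).ne'
    have h1' : ∀ t, smoothAbs δ (t - x) ≠ 0 := fun t => h1 _
    have h2 : ∀ t, smoothAbs δ (t - x) ^ 3 ≠ 0 := fun t => pow_ne_zero _ (h1 _)
    have hint : ∀ F : ℝ → ℝ, Continuous F → IntegrableOn (fun t => α t * F t) (Ioo a b) :=
      fun F hF => ((hα.mul hF.continuousOn).integrableOn_Icc).mono_set Ioo_subset_Icc_self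
    rw [e1, ← integral_sub]
    · refine integral_congr_ae (Eventually.of_forall fun t => ?_)
      beta_reduce
      rw [((hasDerivAt_jumpProfile h hδ (t - x)).comp_sub_const t x).deriv, jumpProfileDeriv]
      ring
    · exact hint _ (by fun_prop (disch := assumption))
    · exact hint _ (by fun_prop (disch := assumption))
  have lim1 := tendsto_integral_concentrating hAm hM hAc hh
  have lim2 : Tendsto (fun δ => ∫ t in Ioo a b, g t * jumpProfile h δ (t - x)) (𝓝[>] 0)
      (𝓝 (∫ t in Ioo a b, g t * jumpProfile h 0 (t - x))) := by
    refine tendsto_integral_filter_of_dominated_convergence (fun t => |g t| * (3 * h ^ 2))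
      (Eventually.of_forall fun δ => hg.integrableOn_deriv.1.mul
        ((measurable_jumpProfile h δ).comp (measurable_id.sub_const x)).aestronglyMeasurable)
      (Eventually.of_forall fun δ => Eventually.of_forall fun t => ?_)
      (hg.integrableOn_deriv.abs.mul_const _)
      (Eventually.of_forall fun t => (tendsto_jumpProfile h (t - x)).const_mul _)
    rw [norm_mul]
    exact mul_le_mul_of_nonneg_left (abs_jumpProfile_le hh δ _) (norm_nonneg _)
  have lim3 : Tendsto (fun δ => ∫ t in Ioo a b,
        α t * (6 * hat h δ (t - x) * ((t - x) / smoothAbs δ (t - x)) ^ 2)) (𝓝[>] 0)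
      (𝓝 (∫ t in Ioo a b, α t * (6 * hat h 0 (t - x)))) := by
    refine tendsto_integral_filter_of_dominated_convergence (fun t => |α t| * (6 * h * 1))
      (Eventually.of_forall fun δ => hg.integrableOn.1.mul ?_)
      (Eventually.of_forall fun δ => Eventually.of_forall fun t => ?_)
      (hg.integrableOn.abs.mul_const _) ?_
    · have := (continuous_hat_right h δ).measurable
      have := (continuous_smoothAbs_right δ).measurable
      exact Measurable.aestronglyMeasurable (by fun_prop)
    · have h1 := hat_le hh δ (t - x)
      have h2 := hat_nonneg h δ (t - x)
      rw [norm_mul, norm_mul, Real.norm_of_nonneg (by positivity : 0 ≤ 6 * hat h δ (t - x)),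
        norm_pow, Real.norm_eq_abs, Real.norm_eq_abs]
      gcongr
      exact pow_le_one₀ (abs_nonneg _) (abs_div_smoothAbs_le _ _)
    · have hne : ∀ᵐ t ∂(volume.restrict (Ioo a b)), t ≠ x := by
        refine ae_restrict_of_ae ?_
        simp [ae_iff]
      filter_upwards [hne] with t ht
      have h1 : smoothAbs 0 (t - x) ≠ 0 := by simpa [smoothAbs_zero, sub_eq_zero] using ht
      have h2 : ContinuousAt (fun δ => α t * (6 * hat h δ (t - x)
          * ((t - x) / smoothAbs δ (t - x)) ^ 2)) 0 := by
        fun_prop (disch := assumption)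
      have h3 := h2.tendsto
      have h4 : ((t - x) / smoothAbs 0 (t - x)) ^ 2 = 1 := by
        rw [div_pow, smoothAbs_zero, sq_abs, div_self]
        exact pow_ne_zero _ (sub_ne_zero.2 ht)
      rw [h4, mul_one] at h3
      exact tendsto_nhdsWithin_of_tendsto_nhds h3
  have := tendsto_nhds_unique (lim1.sub lim3) (lim2.neg.congr' (by
    filter_upwards [hpos] with δ hδ using (key δ hδ).symm))
  rw [hAx] at this
  linarith

/-! ### Signed measures and the vector space structure of `BV` -/

theorem integral_vectorMeasure_toSignedMeasure (μ : Measure ℝ) [IsFiniteMeasure μ] (φ : ℝ → ℝ) :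
    ∫ᵛ t, φ t ∂•μ.toSignedMeasure = ∫ t, φ t ∂μ := by
  rw [← VectorMeasure.integral_toSignedMeasure]
  congr 1
  ext
  simp

theorem integrable_variation {μ : SignedMeasure ℝ} {φ : ℝ → ℝ} {C : ℝ} (hφ : Measurable φ)
    (hC : ∀ t, |φ t| ≤ C) : μ.Integrable φ := by
  have := isFiniteMeasure_variation μ
  exact Integrable.of_bound hφ.aestronglyMeasurable C (Eventually.of_forall hC)

theorem IsTestFunction.exists_bound {a b : ℝ} {φ : ℝ → ℝ} (hφ : IsTestFunction a b φ) :
    ∃ C, ∀ t, |φ t| ≤ C :=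
  hφ.1.continuous.bounded_above_of_compact_support hφ.2.1

theorem IsTestFunction.integrable_vectorMeasure {a b : ℝ} {φ : ℝ → ℝ} (hφ : IsTestFunction a b φ)
    (μ : SignedMeasure ℝ) : μ.Integrable φ :=
  let ⟨_, hC⟩ := hφ.exists_bound
  integrable_variation hφ.1.continuous.measurable hC

theorem IsTestFunction.integrableOn_mul_deriv {a b : ℝ} {φ g : ℝ → ℝ} (hφ : IsTestFunction a b φ)
    (hg : IntegrableOn g (Ioo a b)) : IntegrableOn (fun t => g t * deriv φ t) (Ioo a b) := by
  have hc : Continuous (deriv φ) := hφ.1.continuous_deriv le_rfl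
  obtain ⟨C, hC⟩ := hc.bounded_above_of_compact_support hφ.2.1.deriv
  exact hg.mul_bdd (c := C) hc.aestronglyMeasurable (Eventually.of_forall hC)

theorem totalVariation_add_le (μ ν : SignedMeasure ℝ) :
    (μ + ν).totalVariation ≤ μ.totalVariation + ν.totalVariation := by
  simp only [SignedMeasure.totalVariation_eq_variation]
  exact VectorMeasure.variation_add_le

theorem totalVariation_smul (c : ℝ) (μ : SignedMeasure ℝ) :
    (c • μ).totalVariation = ‖c‖₊ • μ.totalVariation := by
  simp only [SignedMeasure.totalVariation_eq_variation]
  rw [VectorMeasure.variation_smul]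

theorem HasBVDeriv.add {a b : ℝ} {u v : ℝ → ℝ} {Du Dv : SignedMeasure ℝ}
    (hu : HasBVDeriv a b u Du) (hv : HasBVDeriv a b v Dv) :
    HasBVDeriv a b (fun t => u t + v t) (Du + Dv) where
  integrableOn := hu.integrableOn.add hv.integrableOn
  concentrated := by
    refine le_antisymm ((totalVariation_add_le Du Dv _).trans ?_) zero_le
    simp [hu.concentrated, hv.concentrated]
  integral_eq φ hφ := by
    rw [VectorMeasure.integral_add_vectorMeasure (hφ.integrable_vectorMeasure _)
      (hφ.integrable_vectorMeasure _), neg_add, ← hu.integral_eq φ hφ, ← hv.integral_eq φ hφ,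
      ← integral_add (hφ.integrableOn_mul_deriv hu.integrableOn)
        (hφ.integrableOn_mul_deriv hv.integrableOn)]
    simp only [add_mul]

theorem HasBVDeriv.const_mul {a b : ℝ} {u : ℝ → ℝ} {Du : SignedMeasure ℝ}
    (hu : HasBVDeriv a b u Du) (c : ℝ) :
    HasBVDeriv a b (fun t => c * u t) (c • Du) where
  integrableOn := hu.integrableOn.const_mul c
  concentrated := by
    rw [totalVariation_smul, Measure.smul_apply, hu.concentrated, smul_zero]
  integral_eq φ hφ := by
    rw [VectorMeasure.integral_smul_vectorMeasure, smul_eq_mul, ← mul_neg, ← hu.integral_eq φ hφ,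
      ← integral_const_mul]
    simp only [mul_assoc]

theorem HasBVDeriv.neg {a b : ℝ} {u : ℝ → ℝ} {Du : SignedMeasure ℝ}
    (hu : HasBVDeriv a b u Du) : HasBVDeriv a b (fun t => -u t) (-Du) := by
  have h1 : (-1 : ℝ) • Du = -Du := by
    ext s
    simp
  simpa [h1] using hu.const_mul (-1)

theorem HasBVDeriv.sub {a b : ℝ} {u v : ℝ → ℝ} {Du Dv : SignedMeasure ℝ}
    (hu : HasBVDeriv a b u Du) (hv : HasBVDeriv a b v Dv) :
    HasBVDeriv a b (fun t => u t - v t) (Du - Dv) := by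
  simpa [sub_eq_add_neg] using hu.add hv.neg

/-- Lets the integration by parts proved for the weight be applied to test functions too, which
identifies the derivative of the perturbation. -/
theorem IsTestFunction.hasWeakDeriv {a b : ℝ} {φ : ℝ → ℝ} (hφ : IsTestFunction a b φ) :
    HasWeakDeriv a b φ (deriv φ) := by
  have hc : Continuous (deriv φ) := hφ.1.continuous_deriv le_rfl
  have hd : ∀ t, HasDerivAt φ (deriv φ t) t := fun t =>
    (hφ.1.differentiable one_ne_zero t).hasDerivAt
  refine ⟨(hφ.1.continuous.integrable_of_hasCompactSupport hφ.2.1).integrableOn,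
    (hc.integrable_of_hasCompactSupport hφ.2.1.deriv).integrableOn, fun χ hχ => ?_⟩
  have hc' : Continuous (deriv χ) := hχ.1.continuous_deriv le_rfl
  have hd' : ∀ t, HasDerivAt χ (deriv χ t) t := fun t =>
    (hχ.1.differentiable one_ne_zero t).hasDerivAt
  have hout : ∀ t ∉ Ioo a b, φ t = 0 := fun t ht =>
    image_eq_zero_of_notMem_tsupport fun h => ht (hφ.2.2 h)
  have hout' : ∀ t ∉ Ioo a b, χ t = 0 := fun t ht =>
    image_eq_zero_of_notMem_tsupport fun h => ht (hχ.2.2 h)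
  rw [setIntegral_eq_integral_of_forall_compl_eq_zero fun t ht => by simp [hout t ht],
    setIntegral_eq_integral_of_forall_compl_eq_zero fun t ht => by simp [hout' t ht]]
  refine integral_mul_deriv_eq_deriv_mul_of_integrable (fun t _ => hd t) (fun t _ => hd' t) ?_ ?_ ?_
  · exact (hφ.1.continuous.mul hc').integrable_of_hasCompactSupport hφ.2.1.mul_right
  · exact (hc.mul hχ.1.continuous).integrable_of_hasCompactSupport hχ.2.1.mul_left
  · exact (hφ.1.continuous.mul hχ.1.continuous).integrable_of_hasCompactSupport hφ.2.1.mul_right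

/-! ### The perturbation, its derivative and its effect on the total variation -/

/-- The absolutely continuous part `6 (h - |t - x|)₊ dt` of the derivative of the negative of
`jumpProfile h 0`. -/
noncomputable def hatMeasure (h x : ℝ) : Measure ℝ :=
  volume.withDensity fun t => ENNReal.ofReal (6 * hat h 0 (t - x))

theorem continuous_hat_sub (h x : ℝ) : Continuous fun t => 6 * hat h 0 (t - x) := by fun_prop

theorem hat_sub_eq_zero {a b h x t : ℝ} (hl : a < x - h) (hr : x + h < b) (ht : t ∉ Ioo a b) :
    hat h 0 (t - x) = 0 := by
  refine hat_eq_zero 0 ?_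
  by_contra! hlt
  rw [abs_lt] at hlt
  exact ht ⟨by linarith, by linarith⟩

theorem integrable_hat_sub (h x : ℝ) : Integrable fun t => 6 * hat h 0 (t - x) := by
  refine (continuous_hat_sub h x).integrable_of_hasCompactSupport ?_
  refine HasCompactSupport.intro (isCompact_Icc (a := x - h) (b := x + h)) fun t ht => ?_
  refine mul_eq_zero_of_right _ (hat_eq_zero 0 ?_)
  by_contra! hlt
  rw [abs_lt] at hlt
  exact ht ⟨by linarith, by linarith⟩

instance (h x : ℝ) : IsFiniteMeasure (hatMeasure h x) :=
  isFiniteMeasure_withDensity_ofReal (integrable_hat_sub h x).2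

theorem setIntegral_hatMeasure (h x : ℝ) {s : Set ℝ} (hs : MeasurableSet s) (φ : ℝ → ℝ) :
    ∫ t in s, φ t ∂hatMeasure h x = ∫ t in s, φ t * (6 * hat h 0 (t - x)) := by
  rw [hatMeasure, setIntegral_withDensity_eq_setIntegral_toReal_smul
    (by fun_prop) (Eventually.of_forall fun t => ENNReal.ofReal_lt_top) _ hs]
  refine integral_congr_ae (Eventually.of_forall fun t => ?_)
  simp only [smul_eq_mul]
  rw [ENNReal.toReal_ofReal (mul_nonneg (by norm_num) (hat_nonneg _ _ _)), mul_comm]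

/-- The derivative of the negative of `jumpProfile h 0` centred at `x`. -/
noncomputable def jumpDeriv (h x : ℝ) : SignedMeasure ℝ :=
  (hatMeasure h x).toSignedMeasure - (3 * h ^ 2 * kernelMass) • (Measure.dirac x).toSignedMeasure

/-- The defining identity against a test function `φ` is `HasWeakDeriv.integral_mul_jumpProfile`
with `φ` in the role of the weight. -/
theorem hasBVDeriv_jumpProfile {a b h x : ℝ} (hh : 0 < h) (hl : a < x - h) (hr : x + h < b) :
    HasBVDeriv a b (fun t => -jumpProfile h 0 (t - x)) (jumpDeriv h x) where
  integrableOn := by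
    refine Integrable.neg (Integrable.of_bound (C := 3 * h ^ 2)
      ((measurable_jumpProfile h 0).comp (measurable_id.sub_const x)).aestronglyMeasurable ?_)
    exact Eventually.of_forall fun t => abs_jumpProfile_le hh 0 _
  concentrated := by
    have hxI : x ∈ Ioo a b := ⟨by linarith, by linarith⟩
    rw [jumpDeriv, sub_eq_add_neg]
    refine le_antisymm ((totalVariation_add_le _ _ _).trans ?_) zero_le
    rw [SignedMeasure.totalVariation_neg, Measure.add_apply, totalVariation_smul,
      SignedMeasure.totalVariation_eq_variation, SignedMeasure.totalVariation_eq_variation,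
      Measure.variation_toSignedMeasure, Measure.variation_toSignedMeasure, Measure.smul_apply,
      Measure.dirac_apply' _ measurableSet_Ioo.compl, hatMeasure,
      withDensity_apply _ measurableSet_Ioo.compl]
    rw [setLIntegral_congr_fun (g := fun _ => 0) measurableSet_Ioo.compl fun t ht => by
      simp [hat_sub_eq_zero hl hr ht]]
    simp [hxI.1, hxI.2]
  integral_eq φ hφ := by
    have h1 := hφ.hasWeakDeriv.integral_mul_jumpProfile hφ.1.continuous.continuousOn hh hl hr
    have h2 : ∫ t, φ t ∂hatMeasure h x = ∫ t in Ioo a b, φ t * (6 * hat h 0 (t - x)) := by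
      rw [← setIntegral_univ, setIntegral_hatMeasure h x MeasurableSet.univ, setIntegral_univ]
      exact (setIntegral_eq_integral_of_forall_compl_eq_zero
        fun t ht => by simp [hat_sub_eq_zero hl hr ht]).symm
    rw [jumpDeriv, VectorMeasure.integral_sub_vectorMeasure (hφ.integrable_vectorMeasure _)
      (hφ.integrable_vectorMeasure _), VectorMeasure.integral_smul_vectorMeasure,
      integral_vectorMeasure_toSignedMeasure, integral_vectorMeasure_toSignedMeasure,
      integral_dirac, smul_eq_mul, h2, ← h1, ← integral_neg]
    refine integral_congr_ae (Eventually.of_forall fun t => ?_)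
    simp only
    ring

/-- Moving a part of a positive atom of `Du` to a neighbourhood decreases the total variation. -/
theorem totalVariation_add_jumpDeriv_le {Du : SignedMeasure ℝ} {h x ε : ℝ} (hε : 0 ≤ ε)
    (hεx : ε * (3 * h ^ 2 * kernelMass) ≤ Du {x}) :
    (Du + ε • jumpDeriv h x).totalVariation
        + ENNReal.ofReal (ε * (3 * h ^ 2 * kernelMass)) • Measure.dirac x
      ≤ Du.totalVariation + ENNReal.ofReal ε • hatMeasure h x := by
  set c := 3 * h ^ 2 * kernelMass with hc
  have hc0 : 0 ≤ c := mul_nonneg (by positivity) kernelMass_nonneg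
  have hεc : 0 ≤ ε * c := mul_nonneg hε hc0
  have hle : (Du + ε • jumpDeriv h x).totalVariation ≤ Du.totalVariation.restrict {x}ᶜ
      + ENNReal.ofReal (Du {x} - ε * c) • Measure.dirac x + ENNReal.ofReal ε • hatMeasure h x := by
    rw [SignedMeasure.totalVariation_eq_variation]
    refine VectorMeasure.variation_le_of_forall_enorm_le fun s hs => ?_
    -- With the atom at `x` split off, the Dirac part meets only `Du {x}`, and `Du {x} - ε * c` is
    -- nonnegative by hypothesis, so its absolute value is exactly smaller by `ε * c`.
    have hsplit : Du s = Du (s \ {x}) + s.indicator (fun _ => Du {x}) x := by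
      by_cases hx : x ∈ s
      · rw [indicator_of_mem hx]
        have := VectorMeasure.of_add_of_sdiff (v := Du) (measurableSet_singleton x) hs
          (singleton_subset_iff.2 hx)
        linarith
      · simp [hx, sdiff_singleton_eq_self hx]
    have hval : (Du + ε • jumpDeriv h x) s = Du (s \ {x})
        + s.indicator (fun _ => Du {x} - ε * c) x + ε * (hatMeasure h x).real s := by
      rw [_root_.add_apply, _root_.smul_apply, jumpDeriv, _root_.sub_apply,
        _root_.smul_apply, Measure.toSignedMeasure_apply_measurable hs,
        Measure.toSignedMeasure_apply_measurable hs, hsplit]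
      by_cases hx : x ∈ s <;> simp [hx, measureReal_def, hs, ← hc]
      all_goals ring
    rw [hval]
    refine (enorm_add_le _ _).trans ?_
    rw [Measure.add_apply, Measure.add_apply]
    gcongr
    · refine (enorm_add_le _ _).trans ?_
      gcongr
      · rw [Measure.restrict_apply hs, ← sdiff_eq_compl_inter.trans (inter_comm _ _)]
        exact SignedMeasure.enorm_le_totalVariation _ _
      · rw [Measure.smul_apply, Measure.dirac_apply' _ hs]
        by_cases hx : x ∈ s
        · simp [hx, Real.enorm_of_nonneg (sub_nonneg.2 hεx)]
        · simp [hx]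
    · rw [Measure.smul_apply, enorm_mul, Real.enorm_of_nonneg hε,
        Real.enorm_of_nonneg measureReal_nonneg, measureReal_def,
        ENNReal.ofReal_toReal (measure_ne_top _ _), smul_eq_mul]
  have hx : ENNReal.ofReal (Du {x}) ≤ Du.totalVariation {x} := by
    rw [← Real.enorm_of_nonneg (hεc.trans hεx)]
    exact SignedMeasure.enorm_le_totalVariation _ _
  calc (Du + ε • jumpDeriv h x).totalVariation + ENNReal.ofReal (ε * c) • Measure.dirac x
      ≤ Du.totalVariation.restrict {x}ᶜ + ENNReal.ofReal (Du {x} - ε * c) • Measure.dirac x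
        + ENNReal.ofReal ε • hatMeasure h x + ENNReal.ofReal (ε * c) • Measure.dirac x := by gcongr
    _ = Du.totalVariation.restrict {x}ᶜ + ENNReal.ofReal (Du {x}) • Measure.dirac x
        + ENNReal.ofReal ε • hatMeasure h x := by
      rw [add_right_comm, add_assoc (Du.totalVariation.restrict {x}ᶜ), ← add_smul,
        ← ENNReal.ofReal_add (sub_nonneg.2 hεx) hεc, sub_add_cancel]
    _ ≤ Du.totalVariation.restrict {x}ᶜ + Du.totalVariation {x} • Measure.dirac x
        + ENNReal.ofReal ε • hatMeasure h x := by gcongr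
    _ = _ := by
      rw [← Measure.restrict_singleton, Measure.restrict_compl_add_restrict
        (measurableSet_singleton x)]

/-! ### Essential boundedness of functions of bounded variation -/

theorem isTestFunction_primitive {a b c d : ℝ} {η : ℝ → ℝ} (hη : Continuous η) (hac : a < c)
    (hdb : d < b) (h0 : ∀ t ∉ Icc c d, η t = 0) (hint : ∫ t, η t = 0) :
    IsTestFunction a b (fun t => ∫ s in a..t, η s) := by
  have hd : ∀ t, HasDerivAt (fun t => ∫ s in a..t, η s) (η t) t := fun t =>
    hη.integral_hasStrictDerivAt a t |>.hasDerivAt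
  have hs : tsupport (fun t => ∫ s in a..t, η s) ⊆ Icc c d := by
    refine closure_minimal (fun t ht => ?_) isClosed_Icc
    by_contra hc
    refine ht ?_
    rcases lt_or_ge t c with htc | htc
    · refine (intervalIntegral.integral_congr (g := fun _ => 0) fun s hs => h0 s fun h => ?_).trans
        (by simp)
      exact absurd (h.1.trans hs.2) (not_le.2 (max_lt hac htc))
    · have htd : d < t := by
        by_contra! h
        exact hc ⟨htc, h⟩
      beta_reduce
      rw [intervalIntegral.integral_of_le (hac.le.trans htc),
        setIntegral_eq_integral_of_forall_compl_eq_zero, hint]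
      exact fun s hs => h0 s fun h => hs ⟨hac.trans_le h.1, h.2.trans htd.le⟩
  refine ⟨?_, ?_, fun t ht => ?_⟩
  · rw [contDiff_one_iff_deriv]
    refine ⟨fun t => (hd t).differentiableAt, ?_⟩
    rwa [funext fun t => (hd t).deriv]
  · exact isCompact_Icc.of_isClosed_subset (isClosed_tsupport _) hs
  · have := hs ht
    exact ⟨by linarith [this.1], by linarith [this.2]⟩

/-- The primitive of a difference of two probability densities is a test function with values in
`[-1, 1]`; pairing it with `Dg` costs at most the total variation. Thus any two weighted means of
`g` differ by a bounded amount. -/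
theorem HasBVDeriv.abs_integral_mul_sub_le {a b c d : ℝ} {g ξ ρ : ℝ → ℝ} {Dg : SignedMeasure ℝ}
    (hg : HasBVDeriv a b g Dg) (hac : a < c) (hdb : d < b)
    (hξ : Continuous ξ) (hξ0 : ∀ t, 0 ≤ ξ t) (hξs : ∀ t ∉ Icc c d, ξ t = 0) (hξ1 : ∫ t, ξ t = 1)
    (hρ : Continuous ρ) (hρ0 : ∀ t, 0 ≤ ρ t) (hρs : ∀ t ∉ Icc c d, ρ t = 0) (hρ1 : ∫ t, ρ t = 1) :
    |∫ t in Ioo a b, g t * (ξ t - ρ t)| ≤ Dg.variation.real univ := by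
  have hiξ : Integrable ξ := hξ.integrable_of_hasCompactSupport
    (HasCompactSupport.intro isCompact_Icc hξs)
  have hiρ : Integrable ρ := hρ.integrable_of_hasCompactSupport
    (HasCompactSupport.intro isCompact_Icc hρs)
  have hη : Continuous fun t => ξ t - ρ t := hξ.sub hρ
  have ht := isTestFunction_primitive hη hac hdb (fun t ht => by rw [hξs t ht, hρs t ht, sub_zero])
    (by rw [integral_sub hiξ hiρ, hξ1, hρ1, sub_self])
  have hbd : ∀ t, |∫ s in a..t, (ξ s - ρ s)| ≤ 1 := by
    intro t
    rcases lt_or_ge t a with hta | hat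
    · have : t ∉ tsupport (fun t => ∫ s in a..t, (ξ s - ρ s)) := fun h =>
        absurd (ht.2.2 h).1 (not_lt.2 hta.le)
      have h0 := image_eq_zero_of_notMem_tsupport this
      rw [h0]; simp
    · rw [intervalIntegral.integral_of_le hat, integral_sub hiξ.integrableOn hiρ.integrableOn]
      have h1 := setIntegral_le_integral (s := Ioc a t) hiξ (Eventually.of_forall hξ0)
      have h2 := setIntegral_le_integral (s := Ioc a t) hiρ (Eventually.of_forall hρ0)
      have h3 : 0 ≤ ∫ s in Ioc a t, ξ s := integral_nonneg hξ0
      have h4 : 0 ≤ ∫ s in Ioc a t, ρ s := integral_nonneg hρ0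
      rw [abs_le]
      constructor <;> linarith
  have := hg.integral_eq _ ht
  have hderiv : ∀ t, deriv (fun t => ∫ s in a..t, (ξ s - ρ s)) t = ξ t - ρ t := fun t =>
    (hη.integral_hasStrictDerivAt a t).hasDerivAt.deriv
  simp only [hderiv] at this
  rw [this, abs_neg]
  have := isFiniteMeasure_variation Dg
  refine (VectorMeasure.norm_integral_le_of_norm_le_const (μ := Dg) (C := 1)
    (B := ContinuousLinearMap.lsmul ℝ ℝ)
    (f := fun t => ∫ s in a..t, (ξ s - ρ s)) (Eventually.of_forall hbd)).trans ?_
  rw [one_mul]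
  exact mul_le_of_le_one_left measureReal_nonneg ContinuousLinearMap.opNorm_lsmul_le

/-- Functions of bounded variation on a bounded interval are essentially bounded. -/
theorem HasBVDeriv.exists_ae_bound {a b : ℝ} {g : ℝ → ℝ} {Dg : SignedMeasure ℝ}
    (hg : HasBVDeriv a b g Dg) : ∃ C, ∀ᵐ t ∂volume.restrict (Ioo a b), |g t| ≤ C := by
  rcases le_or_gt b a with hba | hab
  · exact ⟨0, by simp [Ioo_eq_empty (not_lt.2 hba)]⟩
  let G : ℝ → ℝ := (Ioo a b).indicator g
  have hG : Integrable G := hg.integrableOn.integrable_indicator measurableSet_Ioo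
  -- A fixed reference mean around the midpoint. Almost every value of `g` is a limit of means over
  -- shrinking bumps `κ n`, and each of these is compared with the reference mean.
  let β : ContDiffBump ((a + b) / 2 : ℝ) :=
    ⟨(b - a) / 8, (b - a) / 4, by linarith, by linarith⟩
  let ρ : ℝ → ℝ := β.normed volume
  refine ⟨|∫ t in Ioo a b, g t * ρ t| + Dg.variation.real univ, ?_⟩
  let κ : ℕ → ContDiffBump (0 : ℝ) := fun n =>
    ⟨1 / (n + 1) / 2, 1 / (n + 1), by positivity, half_lt_self (by positivity)⟩
  have hκ : Tendsto (fun n => (κ n).rOut) atTop (𝓝 0) := tendsto_one_div_add_atTop_nhds_zero_nat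
  have hconv := ContDiffBump.ae_convolution_tendsto_right_of_locallyIntegrable (μ := volume)
    (K := 2) hκ (Eventually.of_forall fun n => by simp [κ]; linarith) hG.locallyIntegrable
  rw [ae_restrict_iff' measurableSet_Ioo]
  filter_upwards [hconv] with x hx hxI
  have hGx : G x = g x := indicator_of_mem hxI _
  rw [hGx] at hx
  refine le_of_tendsto hx.abs ?_
  have hev : ∀ᶠ n in atTop, (κ n).rOut < min (x - a) (b - x) :=
    hκ.eventually_lt_const (lt_min (by linarith [hxI.1]) (by linarith [hxI.2]))
  filter_upwards [hev] with n hn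
  rw [lt_min_iff] at hn
  set r := (κ n).rOut with hr
  let ξ : ℝ → ℝ := fun t => (κ n).normed volume (x - t)
  have e1 : ((κ n).normed volume ⋆[ContinuousLinearMap.lsmul ℝ ℝ, volume] G) x
      = ∫ t in Ioo a b, g t * ξ t := by
    rw [convolution_eq_swap, ← integral_indicator measurableSet_Ioo]
    refine integral_congr_ae (Eventually.of_forall fun t => ?_)
    by_cases ht : t ∈ Ioo a b <;> simp [G, ξ, ht, mul_comm]
  have hξc : Continuous ξ := (κ n).continuous_normed.comp (by fun_prop)
  have hρc : Continuous ρ := β.continuous_normed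
  have hsupp : ∀ {c : ℝ} (f : ContDiffBump c) (t : ℝ), f.rOut ≤ |t - c| → f.normed volume t = 0 := by
    intro c f t ht
    by_contra h
    have : t ∈ Function.support (f.normed volume) := h
    rw [f.support_normed_eq, Metric.mem_ball, Real.dist_eq] at this
    linarith
  let c := min (x - r) ((a + b) / 2 - (b - a) / 4)
  let d := max (x + r) ((a + b) / 2 + (b - a) / 4)
  have hξs : ∀ t ∉ Icc c d, ξ t = 0 := by
    intro t ht
    refine hsupp _ _ ?_
    rw [← hr]
    by_contra! hlt
    rw [sub_zero, abs_lt] at hlt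
    exact ht ⟨(min_le_left _ _).trans (by linarith), le_trans (by linarith) (le_max_left _ _)⟩
  have hρs : ∀ t ∉ Icc c d, ρ t = 0 := by
    intro t ht
    refine hsupp _ _ ?_
    by_contra! hlt
    rw [abs_lt] at hlt
    have : β.rOut = (b - a) / 4 := rfl
    exact ht ⟨(min_le_right _ _).trans (by linarith), le_trans (by linarith) (le_max_right _ _)⟩
  have hξ1 : ∫ t, ξ t = 1 := by
    rw [← (κ n).integral_normed (μ := volume)]
    exact integral_sub_left_eq_self ((κ n).normed volume) volume x
  have hbound := hg.abs_integral_mul_sub_le (c := c) (d := d) (lt_min (by linarith) (by linarith))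
    (max_lt (by linarith) (by linarith)) hξc (fun t => (κ n).nonneg_normed _) hξs hξ1 hρc
    (fun t => β.nonneg_normed _) hρs β.integral_normed
  have hmul : ∀ f : ℝ → ℝ, Continuous f → (∀ t ∉ Icc c d, f t = 0) →
      IntegrableOn (fun t => g t * f t) (Ioo a b) := by
    intro f hf hfs
    obtain ⟨C, hC⟩ := hf.bounded_above_of_compact_support (HasCompactSupport.intro isCompact_Icc hfs)
    exact hg.integrableOn.mul_bdd (c := C) hf.aestronglyMeasurable (Eventually.of_forall hC)
  simp only [mul_sub] at hbound
  rw [integral_sub (hmul ξ hξc hξs) (hmul ρ hρc hρs)] at hbound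
  rw [e1]
  calc _ = |(∫ t in Ioo a b, g t * ρ t)
        + ((∫ t in Ioo a b, g t * ξ t) - ∫ t in Ioo a b, g t * ρ t)| := by
        rw [add_sub_cancel]
    _ ≤ _ := (abs_add_le _ _).trans (by gcongr)

/-! ### First variation and localisation at the jump -/

/-- The first variation of the functional in the direction `-jumpProfile h 0 (· - x)`. -/
theorem IsSolution.integral_mul_jumpProfile_nonneg {a b h x : ℝ} {f α α' u : ℝ → ℝ}
    {Df Du : SignedMeasure ℝ} (hf : HasBVDeriv a b f Df) (hα : ContinuousOn α (Icc a b))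
    (hα_pos : ∀ t ∈ Icc a b, 0 < α t) (hα_deriv : HasWeakDeriv a b α α')
    (hu : IsSolution a b f α u Du) (hux : 0 < Du {x}) (hh : 0 < h) (hl : a < x - h)
    (hr : x + h < b) :
    0 ≤ (∫ t in Ioo a b, (f t - u t) * jumpProfile h 0 (t - x))
      + ∫ t in Ioo a b, α' t * jumpProfile h 0 (t - x) := by
  have hxI : x ∈ Ioo a b := ⟨by linarith, by linarith⟩
  set ψ : ℝ → ℝ := fun t => jumpProfile h 0 (t - x) with hψ
  set c := 3 * h ^ 2 * kernelMass with hc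
  have hc0 : 0 ≤ c := mul_nonneg (by positivity) kernelMass_nonneg
  have hψm : AEStronglyMeasurable ψ (volume.restrict (Ioo a b)) :=
    ((measurable_jumpProfile h 0).comp (measurable_id.sub_const x)).aestronglyMeasurable
  have hψb : ∀ t, ‖ψ t‖ ≤ 3 * h ^ 2 := fun t => abs_jumpProfile_le hh 0 _
  have hψi : IntegrableOn ψ (Ioo a b) := Integrable.of_bound hψm _ (Eventually.of_forall hψb)
  have hψ2 : IntegrableOn (fun t => ψ t ^ 2) (Ioo a b) := by
    simp only [sq]
    exact hψi.mul_bdd hψm (Eventually.of_forall hψb)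
  have hfu := hf.sub hu.1
  have hfui := hfu.integrableOn
  have hfuψ : IntegrableOn (fun t => (f t - u t) * ψ t) (Ioo a b) :=
    hfui.mul_bdd hψm (Eventually.of_forall hψb)
  -- Expanding the square in the energy needs this: a non-integrable square would have integral `0`
  -- by convention.
  have hfu2 : IntegrableOn (fun t => (f t - u t) ^ 2) (Ioo a b) := by
    obtain ⟨C, hC⟩ := hfu.exists_ae_bound
    simp only [sq]
    exact hfui.mul_bdd hfui.1 hC
  have hαi : ∀ μ : Measure ℝ, IsFiniteMeasure μ → IntegrableOn α (Ioo a b) μ := fun μ _ =>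
    (hα.integrableOn_compact isCompact_Icc).mono_set Ioo_subset_Icc_self
  have hE := hα_deriv.integral_mul_jumpProfile hα hh hl hr
  rw [← hc] at hE
  have hvar : ∀ ε : ℝ, 0 < ε → ε * c ≤ Du {x} →
      0 ≤ ((∫ t in Ioo a b, (f t - u t) * ψ t) + ∫ t in Ioo a b, α' t * ψ t)
        + ε * ((1 / 2) * ∫ t in Ioo a b, ψ t ^ 2) := by
    intro ε hε hεc
    have hεc0 : 0 ≤ ε * c := by positivity
    have hmin := hu.2 _ _ (hu.1.add ((hasBVDeriv_jumpProfile hh hl hr).const_mul ε))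
    have hsq : ∫ t in Ioo a b, (f t - (u t + ε * -jumpProfile h 0 (t - x))) ^ 2
        = (∫ t in Ioo a b, (f t - u t) ^ 2) + 2 * ε * (∫ t in Ioo a b, (f t - u t) * ψ t)
          + ε ^ 2 * ∫ t in Ioo a b, ψ t ^ 2 := by
      rw [← integral_const_mul, ← integral_const_mul, ← integral_add hfu2 (hfuψ.const_mul _),
        ← integral_add ?_ (hψ2.const_mul _)]
      rotate_left
      · exact hfu2.add (hfuψ.const_mul (2 * ε))
      · refine integral_congr_ae (Eventually.of_forall fun t => ?_)
        simp only [hψ]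
        ring
    have htv : (∫ t in Ioo a b, α t ∂(Du + ε • jumpDeriv h x).totalVariation) + ε * c * α x
        ≤ (∫ t in Ioo a b, α t ∂Du.totalVariation)
          + ε * ∫ t in Ioo a b, α t * (6 * hat h 0 (t - x)) := by
      have hle := totalVariation_add_jumpDeriv_le hε.le hεc
      rw [← hc] at hle
      have hfin : ∀ (r : ℝ) (μ : Measure ℝ), IsFiniteMeasure μ →
          IsFiniteMeasure (ENNReal.ofReal r • μ) := fun r μ _ =>
        Measure.smul_finite _ ENNReal.ofReal_ne_top
      have hd : IntegrableOn α (Ioo a b) (ENNReal.ofReal (ε * c) • Measure.dirac x) :=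
        hαi _ (hfin _ _ inferInstance)
      have hm : IntegrableOn α (Ioo a b) (ENNReal.ofReal ε • hatMeasure h x) :=
        hαi _ (hfin _ _ inferInstance)
      have key := integral_mono_measure (Measure.restrict_mono_measure hle (Ioo a b))
        ((ae_restrict_iff' measurableSet_Ioo).2 (Eventually.of_forall fun t ht =>
          (hα_pos t (Ioo_subset_Icc_self ht)).le))
        (by
          rw [Measure.restrict_add]
          exact Integrable.add_measure (hαi Du.totalVariation inferInstance) hm)
      rw [Measure.restrict_add, Measure.restrict_add, integral_add_measure (hαi _ inferInstance) hd,
        integral_add_measure (hαi _ inferInstance) hm, Measure.restrict_smul, Measure.restrict_smul,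
        integral_smul_measure, integral_smul_measure, setIntegral_hatMeasure _ _ measurableSet_Ioo,
        ENNReal.toReal_ofReal hεc0, ENNReal.toReal_ofReal hε.le, restrict_dirac' measurableSet_Ioo,
        if_pos hxI, integral_dirac, smul_eq_mul, smul_eq_mul] at key
      exact key
    unfold energy at hmin
    rw [hsq] at hmin
    -- By integration by parts, the bound on the change of the weighted variation is `ε ∫ α' ψ`; the
    -- terms with `α x` disappear.
    have hE' : ε * (∫ t in Ioo a b, α' t * ψ t)
        = ε * (∫ t in Ioo a b, α t * (6 * hat h 0 (t - x))) - ε * c * α x := by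
      rw [hE]; ring
    refine le_of_mul_le_mul_left ?_ hε
    nlinarith
  set S := (∫ t in Ioo a b, (f t - u t) * ψ t) + ∫ t in Ioo a b, α' t * ψ t
  have hlim : Tendsto (fun ε : ℝ => S + ε * ((1 / 2) * ∫ t in Ioo a b, ψ t ^ 2)) (𝓝[>] 0)
      (𝓝 S) := by
    refine tendsto_nhdsWithin_of_tendsto_nhds ?_
    have : Continuous fun ε : ℝ => S + ε * ((1 / 2) * ∫ t in Ioo a b, ψ t ^ 2) := by fun_prop
    simpa using this.tendsto 0
  have hsmall : ∀ᶠ ε : ℝ in 𝓝[>] 0, ε * c < Du {x} := by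
    refine eventually_nhdsWithin_of_eventually_nhds ?_
    have : Continuous fun ε : ℝ => ε * c := by fun_prop
    refine (this.tendsto 0).eventually_lt_const ?_
    simpa using hux
  refine ge_of_tendsto hlim ?_
  filter_upwards [hsmall, eventually_mem_nhdsWithin] with ε h1 h2 using hvar ε h2 h1.le

/-- The mass of a point is the limit of the integrals of normalised shrinking bumps. -/
theorem tendsto_integral_hat_pow (μ : SignedMeasure ℝ) (x : ℝ) :
    Tendsto (fun h => ∫ᵛ t, (h⁻¹ * hat h 0 (t - x)) ^ 3 ∂•μ) (𝓝[>] 0) (𝓝 (μ {x})) := by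
  have := isFiniteMeasure_variation μ
  have hμ : ∫ᵛ t, ({x} : Set ℝ).indicator (fun _ => (1 : ℝ)) t ∂•μ = μ {x} := by
    rw [VectorMeasure.integral_indicator (measurableSet_singleton x),
      VectorMeasure.setIntegral_const]
    simp
  rw [← hμ]
  have hpos : ∀ᶠ h : ℝ in 𝓝[>] 0, 0 < h := eventually_mem_nhdsWithin
  refine VectorMeasure.tendsto_integral_filter_of_norm_le_const
    (Eventually.of_forall fun h => Continuous.aestronglyMeasurable (by fun_prop))
    ⟨1, ?_⟩ (Eventually.of_forall fun t => ?_)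
  · filter_upwards [hpos] with h hh
    refine Eventually.of_forall fun t => ?_
    have h1 : 0 ≤ h⁻¹ * hat h 0 (t - x) := mul_nonneg (inv_nonneg.2 hh.le) (hat_nonneg _ _ _)
    rw [Real.norm_of_nonneg (pow_nonneg h1 _)]
    refine pow_le_one₀ h1 ?_
    calc h⁻¹ * hat h 0 (t - x) ≤ h⁻¹ * h := by
          gcongr
          exact hat_le hh _ _
      _ = 1 := inv_mul_cancel₀ hh.ne'
  · refine tendsto_const_nhds.congr' ?_
    rcases eq_or_ne t x with rfl | hne
    · filter_upwards [hpos] with h hh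
      simp [hat_zero_zero hh, hh.ne']
    · have : ∀ᶠ h : ℝ in 𝓝[>] 0, h < |t - x| := eventually_nhdsWithin_of_eventually_nhds
        (Iio_mem_nhds (abs_pos.2 (sub_ne_zero.2 hne)))
      filter_upwards [this] with h hh
      simp [hat_eq_zero 0 hh.le, hne]

/-- At an upward jump of the solution, the jump is at most the sum of the jumps of the data and
of the derivative of the weight. -/
theorem IsSolution.jump_le {a b x : ℝ} {f α α' u : ℝ → ℝ} {Df Dα' Du : SignedMeasure ℝ}
    (hf : HasBVDeriv a b f Df) (hα : ContinuousOn α (Icc a b))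
    (hα_pos : ∀ t ∈ Icc a b, 0 < α t) (hα_deriv : HasWeakDeriv a b α α')
    (hα' : HasBVDeriv a b α' Dα') (hu : IsSolution a b f α u Du) (hx : x ∈ Ioo a b)
    (hux : 0 < Du {x}) : Du {x} ≤ Df {x} + Dα' {x} := by
  have hg := (hf.sub hu.1).add hα'
  have hlim := tendsto_integral_hat_pow (Df - Du + Dα') x
  have hnonneg : 0 ≤ (Df - Du + Dα') {x} := by
    refine ge_of_tendsto hlim ?_
    have h1 : ∀ᶠ h : ℝ in 𝓝[>] 0, h < min (x - a) (b - x) :=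
      eventually_nhdsWithin_of_eventually_nhds
        (Iio_mem_nhds (lt_min (sub_pos.2 hx.1) (sub_pos.2 hx.2)))
    filter_upwards [h1, eventually_mem_nhdsWithin] with h h1 hh
    rw [lt_min_iff] at h1
    replace hh : 0 < h := hh
    have hl : a < x - h := by linarith
    have hr : x + h < b := by linarith
    have hψm : AEStronglyMeasurable (fun t => jumpProfile h 0 (t - x))
        (volume.restrict (Ioo a b)) :=
      ((measurable_jumpProfile h 0).comp (measurable_id.sub_const x)).aestronglyMeasurable
    have hψb : ∀ᵐ t ∂volume.restrict (Ioo a b), ‖jumpProfile h 0 (t - x)‖ ≤ 3 * h ^ 2 :=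
      Eventually.of_forall fun t => abs_jumpProfile_le hh 0 _
    have h2 := hu.integral_mul_jumpProfile_nonneg hf hα hα_pos hα_deriv hux hh hl hr
    rw [← integral_add ((hf.sub hu.1).integrableOn.mul_bdd hψm hψb)
      (hα'.integrableOn.mul_bdd hψm hψb)] at h2
    simp only [← add_mul] at h2
    rw [hg.integral_mul_jumpProfile hh hl hr] at h2
    simp only [mul_pow]
    have h3 := VectorMeasure.integral_fun_smul (μ := Df - Du + Dα')
      (B := ContinuousLinearMap.lsmul ℝ ℝ) (h⁻¹ ^ 3) fun t => hat h 0 (t - x) ^ 3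
    simp only [smul_eq_mul] at h3
    rw [h3]
    positivity
  simp only [_root_.add_apply, _root_.sub_apply] at hnonneg
  linarith

/-! ### Sign symmetry and conclusion -/

theorem IsSolution.neg {a b : ℝ} {f α u : ℝ → ℝ} {Du : SignedMeasure ℝ}
    (hu : IsSolution a b f α u Du) :
    IsSolution a b (fun t => -f t) α (fun t => -u t) (-Du) := by
  have hneg : ∀ (w : ℝ → ℝ) (Dw : SignedMeasure ℝ),
      energy a b (fun t => -f t) α (fun t => -w t) (-Dw) = energy a b f α w Dw := by
    intro w Dw
    unfold energy
    rw [SignedMeasure.totalVariation_neg]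
    have : ∀ t, (-f t - -w t) ^ 2 = (f t - w t) ^ 2 := fun t => by ring
    simp only [this]
  refine ⟨hu.1.neg, fun w Dw hw => ?_⟩
  have h1 := hneg (fun t => -w t) (-Dw)
  simp only [neg_neg] at h1
  rw [hneg, h1]
  exact hu.2 _ _ hw.neg

theorem totalVariation_real_singleton (μ : SignedMeasure ℝ) (x : ℝ) :
    μ.totalVariation.real {x} = |μ {x}| := by
  refine le_antisymm ?_ (SignedMeasure.norm_le_totalVariation μ {x})
  have h : μ.totalVariation {x} ≤ ‖μ {x}‖ₑ • Measure.dirac x {x} := by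
    rw [SignedMeasure.totalVariation_eq_variation]
    refine VectorMeasure.variation_apply_le_of_forall_enorm_le (measurableSet_singleton x)
      (m := ‖μ {x}‖ₑ • Measure.dirac x) fun s hsm hs => ?_
    rcases subset_singleton_iff_eq.1 hs with rfl | rfl <;> simp
  rw [measureReal_def]
  refine ENNReal.toReal_le_of_le_ofReal (abs_nonneg _) (h.trans ?_)
  simp [Real.enorm_eq_ofReal_abs]

end WeightedTV

theorem corollary3p8 (a b : ℝ) (f α α' u : ℝ → ℝ) (Df Dα' Du : SignedMeasure ℝ)
    (hf : WeightedTV.HasBVDeriv a b f Df)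
    (hα : ContinuousOn α (Icc a b)) (hα_pos : ∀ t ∈ Icc a b, 0 < α t)
    (hα_deriv : WeightedTV.HasWeakDeriv a b α α')
    (hα' : WeightedTV.HasBVDeriv a b α' Dα')
    (hu : WeightedTV.IsSolution a b f α u Du)
    (x : ℝ) (hx : x ∈ Ioo a b)
    (hf_jump : Df.totalVariation {x} ≠ 0) (hα_jump : 0 < Dα' {x}) :
    Du.totalVariation.real {x} ≤ Df.totalVariation.real {x} + Dα' {x} := by
  rw [WeightedTV.totalVariation_real_singleton, WeightedTV.totalVariation_real_singleton]
  rcases lt_trichotomy (Du {x}) 0 with h | h | h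
  -- A downward jump becomes upward under negation of `u` and `f`, while `Dα' {x}` keeps its sign.
  · have := hu.neg.jump_le hf.neg hα hα_pos hα_deriv hα' hx (by simpa using h)
    simp only [_root_.neg_apply] at this
    rw [abs_of_neg h]
    linarith [neg_le_abs (Df {x})]
  · rw [h, abs_zero]
    positivity
  · have := hu.jump_le hf hα hα_pos hα_deriv hα' hx h
    rw [abs_of_pos h]
    linarith [le_abs_self (Df {x})]
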